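/- Let $X$ be one of the following open curves: the real line $\mathbb{R}$; an open interval $(\gamma,\delta)$ with $\gamma<\delta$ real; or an open arc $\{e^{i\theta}: a<\theta<b\}$ of the unit circle with $a<b\le a+2\pi$. Derivatives $u^{(l)}$ of functions $u:X\to\mathbb{C}$ are taken with respect to the real variable in the first two cases and with respect to $\theta$ in the third. For $k\in\{0,1,2,\dots\}\cup\{\infty\}$ let - $C^k(X)$ be the space of $k$ times continuously differentiable functions $u:X\to\mathbb{C}$, with the topology of uniform convergence on compact subsets of $X$ of the derivatives $u^{(l)}$ of all finite orders $l\le k$; - $C^k_b(X)$ be the space of those $u\in C^k(X)$ for which $u^{(l)}$ is bounded for all finite $l\le k$, with the topology defined by the seminorms $\sup_X|u^{(l)}|$, $l\le k$; - $C^k_0(X)$ be the subspace of $C^k_b(X)$ of those $u$ for which $u^{(l)}$ tends to $0$ at both ends of $X$ for all finite $l\le k$. If $X$ is $\mathbb{R}$ or an interval, put $S_+=\{\operatorname{Im}z>0\}$ and $S_-=\{\operatorname{Im}z<0\}$; if $X$ is an arc, put $S_+=\{|z|>1\}$ and $S_-=\{|z|<1\}$. Write $D(z_0,r)$ for the open disc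 with centre $z_0$ and radius $r$. For a side $S\in\{S_+,S_-\}$ say that $u:X\to\mathbb{C}$ extends from the side $S$ at $z_0\in X$ if there are $r>0$ and a continuous function $\lambda:X\cup(D(z_0,r)\cap S)\to\mathbb{C}$ that is holomorphic on $D(z_0,r)\cap S$ and satisfies $\lambda=u$ on $D(z_0,r)\cap X$. In each of the spaces $C^k(X)$, $C_b^k(X)$, $C_0^k(X)$ consider the classes - $U_2(X,k)$: the functions that extend from the side $S_+$ at no point of $X$; - $U_3(X,k)$: the functions that extend from the side $S_-$ at no point of $X$; - $U_4(X,k)$: the functions that extend neither from the side $S_+$ nor from the side $S_-$ at any point of $X$; - $U_5(X,k)$: the functions $u$ for which there are no $z_0\in X$, $r>0$ and holomorphic $f:D(z_0,r)\to\mathbb{C}$ with $f=u$ on $D(z_0,r)\cap X$. Theorem. For every such $X$ and every $k\in\{0,1,2,\dots\}\cup\{\infty\}$, each of the classes $U_2(X,k)$, $U_3(X,k)$, $U_4(X,k)$, $U_5(X,k)$ is a dense $G_\delta$ subset of $C^k(X)$, and the corresponding classes in $C_b^k(X)$ and in $C_0^k(X)$ are dense $G_\delta$ subsets of $C_b^k(X)$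 and of $C_0^k(X)$, respectively. -/

import Mathlib

open Set Filter Topology

namespace OneSidedExtension

/-! ### Function spaces on an open curve

`X` is the curve, viewed as a topological space: the real line, an open interval, or an open arc of
the unit circle.  The map `t : X → ℝ` is its real coordinate, a homeomorphism onto an open subset
of `ℝ`: the identity of `ℝ`, the inclusion of an interval, or the angle on an arc.
Differentiability and derivatives of `u : X → ℂ` are those with respect to this coordinate. -/

section Spaces

variable {X : Type}

/-- The function `u : X → ℂ` written in the coordinate `t`, that is `u ∘ t⁻¹` on the range of `t`
(and `0` outside). -/
noncomputable def inCoord (t : X → ℝ) (u : X → ℂ) : ℝ → ℂ := Function.extend t u 0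

/-- The `l`-th derivative of `u` with respect to the coordinate `t`, as a function on `X`. -/
noncomputable def curveDeriv (t : X → ℝ) (l : ℕ) (u : X → ℂ) : X → ℂ :=
  fun x => iteratedDeriv l (inCoord t u) (t x)

/-- The space `C^k(X)`, `k = 0, 1, 2, …, ∞`. -/
structure Ck (t : X → ℝ) (k : ℕ∞) where
  /-- the underlying function -/
  toFun : X → ℂ
  contDiff : ContDiffOn ℝ (k : WithTop ℕ∞) (inCoord t toFun) (range t)

/-- The space `C_b^k(X)` of the functions in `C^k(X)` all of whose derivatives of order `l ≤ k`
are bounded. -/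
structure Ckb (t : X → ℝ) (k : ℕ∞) extends Ck t k where
  bounded : ∀ l : ℕ, (l : ℕ∞) ≤ k → ∃ C : ℝ, ∀ x : X, ‖curveDeriv t l toFun x‖ ≤ C

/-- The space `C_0^k(X)` of the functions in `C_b^k(X)` all of whose derivatives of order `l ≤ k`
tend to zero at both ends of `X`. -/
structure Ck0 (t : X → ℝ) (k : ℕ∞) [TopologicalSpace X] extends Ckb t k where
  vanishing : ∀ l : ℕ, (l : ℕ∞) ≤ k → Tendsto (curveDeriv t l toFun) (cocompact X) (𝓝 0)

variable [TopologicalSpace X]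

/-- The topology of `C^k(X)`: uniform convergence on the compact subsets of `X` of all derivatives
of order `l ≤ k`. -/
noncomputable instance Ck.instTopologicalSpace (t : X → ℝ) (k : ℕ∞) :
    TopologicalSpace (Ck t k) :=
  ⨅ (l : ℕ) (_ : (l : ℕ∞) ≤ k), TopologicalSpace.induced
    (fun u : Ck t k => UniformOnFun.ofFun {K : Set X | IsCompact K} (curveDeriv t l u.toFun))
    inferInstance

/-- The topology of `C_b^k(X)`: uniform convergence on the whole of `X` of all derivatives of
order `l ≤ k`, i.e. the topology of the seminorms `sup_X |u^(l)|`. -/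
noncomputable instance Ckb.instTopologicalSpace (t : X → ℝ) (k : ℕ∞) :
    TopologicalSpace (Ckb t k) :=
  ⨅ (l : ℕ) (_ : (l : ℕ∞) ≤ k), TopologicalSpace.induced
    (fun u : Ckb t k => UniformFun.ofFun (curveDeriv t l u.toFun)) inferInstance

/-- `C_0^k(X)` is topologized as a subspace of `C_b^k(X)`. -/
noncomputable instance Ck0.instTopologicalSpace (t : X → ℝ) (k : ℕ∞) :
    TopologicalSpace (Ck0 t k) :=
  TopologicalSpace.induced Ck0.toCkb inferInstance

end Spaces

/-! ### Classes of non-extendable functions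

`ι : X → ℂ` is the inclusion of the curve in the plane, and `S`, `S'` are its two sides. -/

section Classes

variable {X : Type}

/-- `u` extends from the side `S` near the point `z₀`: for some `r > 0` there is a function `F`,
continuous on the union of the curve and `D(z₀, r) ∩ S`, holomorphic on `D(z₀, r) ∩ S`, and equal
to `u` on the part of the curve inside `D(z₀, r)`. -/
def ExtendsFromSideAt (ι : X → ℂ) (S : Set ℂ) (u : X → ℂ) (z₀ : ℂ) : Prop :=
  ∃ r : ℝ, 0 < r ∧ ∃ F : ℂ → ℂ,
    ContinuousOn F (range ι ∪ (Metric.ball z₀ r ∩ S)) ∧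
    DifferentiableOn ℂ F (Metric.ball z₀ r ∩ S) ∧
    ∀ x : X, ι x ∈ Metric.ball z₀ r → F (ι x) = u x

/-- `u` extends to a disc centred at `z₀`: for some `r > 0` there is a holomorphic function on
`D(z₀, r)` equal to `u` on the part of the curve inside `D(z₀, r)`. -/
def ExtendsToDiscAt (ι : X → ℂ) (u : X → ℂ) (z₀ : ℂ) : Prop :=
  ∃ r : ℝ, 0 < r ∧ ∃ F : ℂ → ℂ,
    DifferentiableOn ℂ F (Metric.ball z₀ r) ∧
    ∀ x : X, ι x ∈ Metric.ball z₀ r → F (ι x) = u x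

/-- Functions that do not extend from the side `S` at any point of the curve: the class `U₂` when
`S` is the upper half-plane (or the exterior of the unit disc), the class `U₃` when `S` is the
lower half-plane (or the unit disc). -/
def NonextSide (ι : X → ℂ) (S : Set ℂ) : Set (X → ℂ) :=
  {u | ¬ ∃ x₀ : X, ExtendsFromSideAt ι S u (ι x₀)}

/-- The class `U₄` of functions that extend neither from the side `S` nor from the side `S'`, at any
point of the curve. -/
def NonextBothSides (ι : X → ℂ) (S S' : Set ℂ) : Set (X → ℂ) :=
  {u | (¬ ∃ x₀ : X, ExtendsFromSideAt ι S u (ι x₀)) ∧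
       (¬ ∃ x₀ : X, ExtendsFromSideAt ι S' u (ι x₀))}

/-- The class `U₅` of functions that do not extend to any disc centred at a point of the curve. -/
def NonextDisc (ι : X → ℂ) : Set (X → ℂ) :=
  {u | ¬ ∃ x₀ : X, ExtendsToDiscAt ι u (ι x₀)}

/-- The members of the class `U` lying in the function space form a dense `G_δ` subset of it, for
each of the three spaces `C^k(X)`, `C_b^k(X)`, `C_0^k(X)`. -/
def DenseGdeltaInSpaces [TopologicalSpace X] (t : X → ℝ) (k : ℕ∞) (U : Set (X → ℂ)) : Prop :=
  (Dense {u : Ck t k | u.toFun ∈ U} ∧ IsGδ {u : Ck t k | u.toFun ∈ U}) ∧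
  (Dense {u : Ckb t k | u.toFun ∈ U} ∧ IsGδ {u : Ckb t k | u.toFun ∈ U}) ∧
  (Dense {u : Ck0 t k | u.toFun ∈ U} ∧ IsGδ {u : Ck0 t k | u.toFun ∈ U})

end Classes

/-! ### The line, open intervals and open arcs -/

/-- The open upper half-plane. -/
def upperSide : Set ℂ := {z | 0 < z.im}

/-- The open lower half-plane. -/
def lowerSide : Set ℂ := {z | z.im < 0}

/-- The exterior of the closed unit disc. -/
def outerSide : Set ℂ := {z | 1 < ‖z‖}

/-- The open unit disc. -/
def innerSide : Set ℂ := {z | ‖z‖ < 1}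

/-- The inclusion of the real line in the plane. -/
def lineIncl : ℝ → ℂ := fun x => (x : ℂ)

/-- The inclusion of the interval `(γ, δ)` in the plane. -/
def intervalIncl (γ δ : ℝ) : Ioo γ δ → ℂ := fun x => ((x : ℝ) : ℂ)

/-- The point `e^{iθ}`. -/
noncomputable def circlePoint (θ : ℝ) : ℂ := Complex.exp (θ * Complex.I)

/-- The open arc `{e^{iθ} : a < θ < b}` of the unit circle. -/
def openArc (a b : ℝ) : Set ℂ := circlePoint '' Ioo a b

/-- The angle `θ ∈ (a, b)` of a point `e^{iθ}` of the open arc; it is unique if `b ≤ a + 2π`. -/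
noncomputable def arcAngle (a b : ℝ) : openArc a b → ℝ :=
  fun z => Function.invFunOn circlePoint (Ioo a b) (z : ℂ)

theorem arcAngle_mem (a b : ℝ) (z : openArc a b) : arcAngle a b z ∈ Ioo a b :=
  Function.invFunOn_mem z.2

theorem circlePoint_arcAngle (a b : ℝ) (z : openArc a b) :
    circlePoint (arcAngle a b z) = z :=
  Function.invFunOn_eq z.2

/-- The inclusion of the open arc in the plane. -/
def arcIncl (a b : ℝ) : openArc a b → ℂ := Subtype.val

end OneSidedExtension

open OneSidedExtension

/-!
By the two-constants theorem, if functions on the line converge uniformly and their one-sided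
extensions to a disc are uniformly bounded, then the extensions converge up to the line on a
smaller concentric disc, so the limit is extendable there. Hence the functions that extend
somewhere lie in a countable union of closed sets, each consisting of functions extendable on a
fixed disc. Such a closed set has empty interior: it is left by adding arbitrarily small
multiples of a bump function vanishing on part of the disc, which has no extension there because
an extension is determined by its values on any subinterval.

It suffices to perturb by smooth functions on `ℝ` that vanish off an open set `R` and decay at
infinity with all their derivatives. They form a Baire space, and a generic small perturbation
of this kind works at the same time in `C^k`, `C_b^k` and `C_0^k` of `R`. Curves are reduced to
open subsets of `ℝ` by the holomorphic chart that straightens them.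
-/

namespace OneSidedExtension

open Metric
open scoped ContDiff ZeroAtInfty

section Extensions

variable {X : Type*} {ι : X → ℂ} {S : Set ℂ} {u v : X → ℂ} {z₀ : ℂ} {r : ℝ} {F G : ℂ → ℂ}

/-- `F` is an extension of `u : X → ℂ` from the side `S` of the curve `ι` in the disc `D(z₀, r)`.
The continuity of `F` is only asked inside the disc. -/
structure IsExtensionOn (ι : X → ℂ) (S : Set ℂ) (u : X → ℂ) (z₀ : ℂ) (r : ℝ) (F : ℂ → ℂ) :
    Prop where
  continuousOn : ContinuousOn F (ball z₀ r ∩ (range ι ∪ S))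
  differentiableOn : DifferentiableOn ℂ F (ball z₀ r ∩ S)
  apply_eq : ∀ x, ι x ∈ ball z₀ r → F (ι x) = u x

/-- `u` has an extension from the side `S` of the curve `ι` in the disc `D(z₀, r)`. -/
def ExtendsOn (ι : X → ℂ) (S : Set ℂ) (u : X → ℂ) (z₀ : ℂ) (r : ℝ) : Prop :=
  ∃ F, IsExtensionOn ι S u z₀ r F

/-- `u` has an extension from the side `S` of the curve `ι` in the disc `D(z₀, r)` which is bounded
by `M` there. -/
def ExtendsBoundedlyOn (ι : X → ℂ) (S : Set ℂ) (u : X → ℂ) (z₀ : ℂ) (r M : ℝ) : Prop :=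
  ∃ F, IsExtensionOn ι S u z₀ r F ∧ ∀ z ∈ ball z₀ r ∩ (range ι ∪ S), ‖F z‖ ≤ M

theorem IsExtensionOn.comp {Y : Type*} {κ : Y → ℂ} {T : Set ℂ} {v : Y → ℂ} {w₀ : ℂ} {s : ℝ}
    {φ : ℂ → ℂ} (hF : IsExtensionOn ι S u z₀ r F) (hφ : DifferentiableOn ℂ φ (ball w₀ s))
    (hball : MapsTo φ (ball w₀ s) (ball z₀ r)) (hside : MapsTo φ (ball w₀ s ∩ T) S)
    (hcurve : ∀ y, κ y ∈ ball w₀ s → ∃ x, ι x = φ (κ y) ∧ u x = v y) :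
    IsExtensionOn κ T v w₀ s (F ∘ φ) where
  continuousOn := by
    refine hF.continuousOn.comp (hφ.continuousOn.mono inter_subset_left) ?_
    rintro w ⟨hw, ⟨y, rfl⟩ | hwT⟩
    · obtain ⟨x, hx, -⟩ := hcurve y hw
      exact ⟨hball hw, .inl ⟨x, hx⟩⟩
    · exact ⟨hball hw, .inr (hside ⟨hw, hwT⟩)⟩
  differentiableOn := hF.differentiableOn.comp (hφ.mono inter_subset_left)
    fun _ hw => ⟨hball hw.1, hside hw⟩
  apply_eq y hy := by
    obtain ⟨x, hx, hxy⟩ := hcurve y hy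
    rw [Function.comp_apply, ← hx, hF.apply_eq x (hx ▸ hball hy), hxy]

theorem IsExtensionOn.mono {z₁ : ℂ} {s : ℝ} (hF : IsExtensionOn ι S u z₀ r F)
    (h : ball z₁ s ⊆ ball z₀ r) : IsExtensionOn ι S u z₁ s F :=
  hF.comp (φ := id) differentiableOn_id h (fun _ hw => hw.2) fun x _ => ⟨x, rfl, rfl⟩

theorem IsExtensionOn.sub (hF : IsExtensionOn ι S u z₀ r F) (hG : IsExtensionOn ι S v z₀ r G) :
    IsExtensionOn ι S (u - v) z₀ r (F - G) where
  continuousOn := hF.continuousOn.sub hG.continuousOn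
  differentiableOn := hF.differentiableOn.sub hG.differentiableOn
  apply_eq x hx := by simp only [Pi.sub_apply, hF.apply_eq x hx, hG.apply_eq x hx]

theorem IsExtensionOn.const_smul (c : ℂ) (hF : IsExtensionOn ι S u z₀ r F) :
    IsExtensionOn ι S (c • u) z₀ r (c • F) where
  continuousOn := hF.continuousOn.const_smul c
  differentiableOn := hF.differentiableOn.const_smul c
  apply_eq x hx := by simp only [Pi.smul_apply, hF.apply_eq x hx]

theorem ExtendsOn.sub (hu : ExtendsOn ι S u z₀ r) (hv : ExtendsOn ι S v z₀ r) :
    ExtendsOn ι S (u - v) z₀ r :=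
  let ⟨_, hF⟩ := hu
  let ⟨_, hG⟩ := hv
  ⟨_, hF.sub hG⟩

theorem ExtendsOn.const_smul (c : ℂ) (hu : ExtendsOn ι S u z₀ r) : ExtendsOn ι S (c • u) z₀ r :=
  let ⟨_, hF⟩ := hu
  ⟨_, hF.const_smul c⟩

theorem IsExtensionOn.exists_bound (hF : IsExtensionOn ι S u z₀ r F)
    (hS : IsClosed (range ι ∪ S)) {z₁ : ℂ} {s : ℝ} (h : closedBall z₁ s ⊆ ball z₀ r) :
    ∃ M : ℕ, ∀ z ∈ ball z₁ s ∩ (range ι ∪ S), ‖F z‖ ≤ M := by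
  obtain ⟨C, hC⟩ := ((isCompact_closedBall z₁ s).inter_right hS).exists_bound_of_continuousOn
    (hF.continuousOn.mono (inter_subset_inter_left _ h))
  obtain ⟨M, hM⟩ := exists_nat_ge C
  exact ⟨M, fun z hz => (hC z ⟨ball_subset_closedBall hz.1, hz.2⟩).trans hM⟩

theorem ExtendsOn.exists_extendsBoundedlyOn (hu : ExtendsOn ι S u z₀ r)
    (hS : IsClosed (range ι ∪ S)) {z₁ : ℂ} {s : ℝ} (h : closedBall z₁ s ⊆ ball z₀ r) :
    ∃ M : ℕ, ExtendsBoundedlyOn ι S u z₁ s M :=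
  let ⟨F, hF⟩ := hu
  let ⟨M, hM⟩ := hF.exists_bound hS h
  ⟨M, F, hF.mono (ball_subset_closedBall.trans h), hM⟩

end Extensions

section ModelRegions

variable {O : Set ℂ}

/-- The regions from which functions on the real line are extended: the two half-planes, and the
whole plane, for which an extension is just a holomorphic extension to a disc. -/
def modelRegions : Set (Set ℂ) := {upperSide, lowerSide, univ}

theorem upperSide_mem_modelRegions : upperSide ∈ modelRegions := .inl rfl

theorem lowerSide_mem_modelRegions : lowerSide ∈ modelRegions := .inr (.inl rfl)

theorem univ_mem_modelRegions : univ ∈ modelRegions := .inr (.inr rfl)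

theorem countable_modelRegions : modelRegions.Countable :=
  ((countable_singleton _).insert _).insert _

theorem isOpen_of_mem_modelRegions (hO : O ∈ modelRegions) : IsOpen O := by
  rcases hO with rfl | rfl | rfl
  · exact Complex.continuous_im.isOpen_preimage _ isOpen_Ioi
  · exact Complex.continuous_im.isOpen_preimage _ isOpen_Iio
  · exact isOpen_univ

theorem convex_of_mem_modelRegions (hO : O ∈ modelRegions) : Convex ℝ O := by
  rcases hO with rfl | rfl | rfl
  · exact convex_halfSpace_im_gt 0
  · exact convex_halfSpace_im_lt 0
  · exact convex_univ

theorem mem_upperSide {z : ℂ} : z ∈ upperSide ↔ 0 < z.im := Iff.rfl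

theorem mem_lowerSide {z : ℂ} : z ∈ lowerSide ↔ z.im < 0 := Iff.rfl

theorem mem_range_lineIncl {z : ℂ} : z ∈ range lineIncl ↔ z.im = 0 :=
  ⟨fun ⟨_, hx⟩ => hx ▸ Complex.ofReal_im _, fun hz => ⟨z.re, Complex.ext rfl hz.symm⟩⟩

theorem isClosed_range_lineIncl_union (hO : O ∈ modelRegions) :
    IsClosed (range lineIncl ∪ O) := by
  rcases hO with rfl | rfl | rfl
  · convert isClosed_Ici.preimage Complex.continuous_im (t := Ici (0 : ℝ)) using 1
    ext z
    rw [mem_union, mem_range_lineIncl, mem_upperSide, mem_preimage, mem_Ici, le_iff_eq_or_lt,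
      eq_comm]
  · convert isClosed_Iic.preimage Complex.continuous_im (t := Iic (0 : ℝ)) using 1
    ext z
    rw [mem_union, mem_range_lineIncl, mem_lowerSide, mem_preimage, mem_Iic, le_iff_eq_or_lt]
  · simp only [union_univ, isClosed_univ]

theorem lineIncl_mem_closure (hO : O ∈ modelRegions) (x : ℝ) : lineIncl x ∈ closure O := by
  have hx : (lineIncl x).im = 0 := Complex.ofReal_im x
  rcases hO with rfl | rfl | rfl
  · exact (Complex.closure_setOfPred_lt_im 0).ge hx.ge
  · exact (Complex.closure_setOfPred_im_lt 0).ge hx.le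
  · simp only [closure_univ, mem_univ]

theorem exists_halfPlane_subset (hO : O ∈ modelRegions) {z : ℂ} (hz : z ∈ range lineIncl ∪ O) :
    ∃ c : ℝ, |c| = 1 ∧ 0 ≤ c * z.im ∧ ∀ w : ℂ, 0 < c * w.im → w ∈ O := by
  rw [mem_union, mem_range_lineIncl] at hz
  rcases hO with rfl | rfl | rfl
  · rw [mem_upperSide, eq_comm, ← le_iff_eq_or_lt] at hz
    exact ⟨1, abs_one, by rwa [one_mul], fun w hw => by rwa [one_mul] at hw⟩
  · rw [mem_lowerSide, ← le_iff_eq_or_lt] at hz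
    exact ⟨-1, by rw [abs_neg, abs_one], by rwa [neg_one_mul, neg_nonneg],
      fun w hw => by rwa [neg_one_mul, neg_pos] at hw⟩
  · rcases le_total 0 z.im with h | h
    · exact ⟨1, abs_one, by rwa [one_mul], fun w _ => mem_univ w⟩
    · exact ⟨-1, by rw [abs_neg, abs_one], by rwa [neg_one_mul, neg_nonneg],
        fun w _ => mem_univ w⟩

theorem lineIncl_mem_ball {x y r : ℝ} : lineIncl y ∈ ball (lineIncl x) r ↔ y ∈ ball x r := by
  simp only [mem_ball, lineIncl, Complex.isometry_ofReal.dist_eq]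

end ModelRegions

section TwoConstants

variable {O : Set ℂ} {f : ℝ → ℂ} {G : ℂ → ℂ} {x r M δ : ℝ}

/-- The open upper half of the unit disc. -/
def upperHalfDisc : Set ℂ := ball 0 1 ∩ upperSide

theorem closure_upperHalfDisc_subset :
    closure upperHalfDisc ⊆ ball 0 2 ∩ (range lineIncl ∪ upperSide) := by
  refine (closure_inter_subset_inter_closure _ _).trans (inter_subset_inter ?_ ?_)
  · exact closure_ball_subset_closedBall.trans (closedBall_subset_ball one_lt_two)
  · exact closure_minimal subset_union_right
      (isClosed_range_lineIncl_union upperSide_mem_modelRegions)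

theorem im_eq_zero_or_norm_eq_one_of_mem_frontier {z : ℂ} (hz : z ∈ frontier upperHalfDisc) :
    z.im = 0 ∨ 0 ≤ z.im ∧ ‖z‖ = 1 := by
  rcases frontier_inter_subset _ _ hz with ⟨hz₁, hz₂⟩ | ⟨-, hz₂⟩
  · rw [frontier_ball 0 one_ne_zero, mem_sphere_zero_iff_norm] at hz₁
    exact .inr ⟨(Complex.closure_setOfPred_lt_im 0).le hz₂, hz₁⟩
  · exact .inl ((Complex.frontier_setOfPred_lt_im 0).le hz₂)

/-- The weight of the two-constants estimate. Its modulus is at most `1` on the diameter of the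
upper half disc, at most `exp (-A)` on the half circle, and at least `exp (-A / 2)` near `0`. -/
noncomputable def halfDiscWeight (A : ℝ) (z : ℂ) : ℂ :=
  Complex.exp (A * (4 * Complex.I * z - z ^ 2))

theorem norm_halfDiscWeight (A : ℝ) (z : ℂ) :
    ‖halfDiscWeight A z‖ = Real.exp (A * (z.im ^ 2 - z.re ^ 2 - 4 * z.im)) := by
  rw [halfDiscWeight, Complex.norm_exp, Complex.re_ofReal_mul]
  congr 2
  simp only [sq, Complex.sub_re, Complex.mul_re, Complex.mul_im, Complex.I_re, Complex.I_im,
    Complex.re_ofNat, Complex.im_ofNat]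
  ring

theorem differentiable_halfDiscWeight (A : ℝ) : Differentiable ℂ (halfDiscWeight A) := by
  unfold halfDiscWeight
  fun_prop

theorem norm_halfDiscWeight_le_one {A : ℝ} (hA : 0 ≤ A) (y : ℝ) :
    ‖halfDiscWeight A (lineIncl y)‖ ≤ 1 := by
  rw [norm_halfDiscWeight, Real.exp_le_one_iff]
  refine mul_nonpos_of_nonneg_of_nonpos hA ?_
  simp only [lineIncl, Complex.ofReal_im, Complex.ofReal_re]
  nlinarith [sq_nonneg y]

theorem norm_halfDiscWeight_le_exp_neg {A : ℝ} (hA : 0 ≤ A) {z : ℂ} (him : 0 ≤ z.im)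
    (hz : ‖z‖ = 1) : ‖halfDiscWeight A z‖ ≤ Real.exp (-A) := by
  have hre : 1 ^ 2 - z.im ^ 2 = z.re ^ 2 := hz ▸ Complex.sq_norm_sub_sq_im z
  have him₁ : z.im ≤ 1 := hz ▸ (le_abs_self _).trans (Complex.abs_im_le_norm z)
  have hexp : z.im ^ 2 - z.re ^ 2 - 4 * z.im ≤ -1 := by nlinarith
  rw [norm_halfDiscWeight, Real.exp_le_exp]
  nlinarith

theorem exp_neg_half_le_norm_halfDiscWeight {A : ℝ} (hA : 0 ≤ A) {z : ℂ} (hz : ‖z‖ < 1 / 10) :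
    Real.exp (-(A / 2)) ≤ ‖halfDiscWeight A z‖ := by
  have hre := abs_le.1 ((Complex.abs_re_le_norm z).trans hz.le)
  have him := abs_le.1 ((Complex.abs_im_le_norm z).trans hz.le)
  have hexp : -(1 / 2) ≤ z.im ^ 2 - z.re ^ 2 - 4 * z.im := by nlinarith
  rw [norm_halfDiscWeight, Real.exp_le_exp]
  nlinarith

theorem norm_halfDiscWeight_mul_le {A : ℝ} (hA : 0 ≤ A)
    (hG : IsExtensionOn lineIncl upperSide f 0 2 G) (hf : ∀ y ∈ ball 0 2, ‖f y‖ ≤ δ)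
    (hGM : ∀ z ∈ ball 0 2 ∩ (range lineIncl ∪ upperSide), ‖G z‖ ≤ δ * Real.exp A)
    {z : ℂ} (hz : z ∈ closure upperHalfDisc) : ‖halfDiscWeight A z * G z‖ ≤ δ := by
  have hbdd : Bornology.IsBounded upperHalfDisc := isBounded_ball.subset inter_subset_left
  have hW := differentiable_halfDiscWeight A
  have hdiff : DiffContOnCl ℂ (fun z => halfDiscWeight A z * G z) upperHalfDisc :=
    ⟨hW.differentiableOn.mul (hG.differentiableOn.mono
      (inter_subset_inter_left _ (ball_subset_ball one_le_two))),
      hW.continuous.continuousOn.mul (hG.continuousOn.mono closure_upperHalfDisc_subset)⟩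
  refine Complex.norm_le_of_forall_mem_frontier_norm_le hbdd hdiff (fun w hw => ?_) hz
  have hw₂ := closure_upperHalfDisc_subset (frontier_subset_closure hw)
  rw [norm_mul]
  rcases im_eq_zero_or_norm_eq_one_of_mem_frontier hw with him | ⟨him, hw₁⟩
  · obtain ⟨y, rfl⟩ := mem_range_lineIncl.2 him
    have hfy : ‖G (lineIncl y)‖ ≤ δ := hG.apply_eq y hw₂.1 ▸ hf y (lineIncl_mem_ball.1 hw₂.1)
    exact (mul_le_of_le_one_left (norm_nonneg _) (norm_halfDiscWeight_le_one hA y)).trans hfy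
  · calc ‖halfDiscWeight A w‖ * ‖G w‖ ≤ Real.exp (-A) * (δ * Real.exp A) := by
          gcongr
          exacts [norm_halfDiscWeight_le_exp_neg hA him hw₁, hGM w hw₂]
      _ = δ := by rw [mul_left_comm, ← Real.exp_add, neg_add_cancel, Real.exp_zero, mul_one]

theorem two_constants_halfDisc (hδ : 0 < δ) (hδM : δ ≤ M)
    (hG : IsExtensionOn lineIncl upperSide f 0 2 G) (hf : ∀ y ∈ ball 0 2, ‖f y‖ ≤ δ)
    (hGM : ∀ z ∈ ball 0 2 ∩ (range lineIncl ∪ upperSide), ‖G z‖ ≤ M)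
    {z : ℂ} (hz : ‖z‖ < 1 / 10) (him : 0 ≤ z.im) : ‖G z‖ ≤ √(M * δ) := by
  set A := Real.log (M / δ) with hA_def
  have hA : 0 ≤ A := Real.log_nonneg ((one_le_div hδ).2 hδM)
  have hM : M = δ * Real.exp A := by
    rw [hA_def, Real.exp_log (div_pos (hδ.trans_le hδM) hδ), mul_div_cancel₀ _ hδ.ne']
  have hzU : z ∈ closure upperHalfDisc := by
    refine isOpen_ball.inter_closure ⟨?_, (Complex.closure_setOfPred_lt_im 0).ge him⟩
    rw [mem_ball_zero_iff]
    linarith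
  have hWG : Real.exp (-(A / 2)) * ‖G z‖ ≤ δ := by
    refine le_trans ?_ (norm_halfDiscWeight_mul_le hA hG hf (hM ▸ hGM) hzU)
    rw [norm_mul]
    gcongr
    exact exp_neg_half_le_norm_halfDiscWeight hA hz
  rw [Real.exp_neg, inv_mul_le_iff₀ (Real.exp_pos _)] at hWG
  refine hWG.trans (Real.le_sqrt_of_sq_le (le_of_eq ?_))
  rw [hM, mul_pow, ← Real.exp_nat_mul, Nat.cast_ofNat, mul_div_cancel₀ A two_ne_zero]
  ring

theorem exists_halfDisc_chart (hO : O ∈ modelRegions) {z : ℂ}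
    (hz : z ∈ ball (lineIncl x) (r / 20) ∩ (range lineIncl ∪ O)) :
    ∃ φ : ℂ → ℂ, Differentiable ℂ φ ∧ MapsTo φ (ball 0 2) (ball (lineIncl x) r) ∧
      MapsTo φ upperSide O ∧ MapsTo φ (range lineIncl) (range lineIncl) ∧
      ∃ w, ‖w‖ < 1 / 10 ∧ 0 ≤ w.im ∧ φ w = z := by
  obtain ⟨c, hc, hcz, hcO⟩ := exists_halfPlane_subset hO hz.2
  have hr : 0 < r := by linarith [pos_of_mem_ball hz.1]
  have hcc : c * c = 1 := by rw [← abs_mul_abs_self, hc, one_mul]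
  have hc₀ : ((c * (r / 2) : ℝ) : ℂ) ≠ 0 := by
    rw [Complex.ofReal_ne_zero, ← abs_pos, abs_mul, hc, one_mul, abs_of_pos (half_pos hr)]
    exact half_pos hr
  set φ : ℂ → ℂ := fun w => (c * (r / 2) : ℝ) * w + lineIncl x with hφ
  have hφ_norm (w : ℂ) : ‖φ w - lineIncl x‖ = r / 2 * ‖w‖ := by
    rw [hφ, add_sub_cancel_right, norm_mul, Complex.norm_real, Real.norm_eq_abs, abs_mul, hc,
      one_mul, abs_of_pos (half_pos hr)]
  have hφ_im (w : ℂ) : c * (φ w).im = r / 2 * w.im := by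
    simp only [hφ, lineIncl, Complex.add_im, Complex.ofReal_im, Complex.im_ofReal_mul, add_zero]
    linear_combination (r / 2 * w.im) * hcc
  obtain ⟨w, rfl⟩ : ∃ w, φ w = z :=
    ⟨(z - lineIncl x) / (c * (r / 2) : ℝ), by
      simp only [hφ, mul_div_cancel₀ _ hc₀, sub_add_cancel]⟩
  refine ⟨φ, by fun_prop, fun v hv => ?_, fun v hv => hcO _ ?_, ?_, w, ?_, ?_, rfl⟩
  · rw [mem_ball_zero_iff] at hv
    rw [mem_ball_iff_norm, hφ_norm]
    nlinarith
  · rw [hφ_im]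
    exact mul_pos (half_pos hr) hv
  · rintro _ ⟨y, rfl⟩
    exact ⟨c * (r / 2) * y + x, by
      simp only [hφ, lineIncl, Complex.ofReal_add, Complex.ofReal_mul]⟩
  · have hw := hz.1
    rw [mem_ball_iff_norm, hφ_norm] at hw
    nlinarith
  · rw [hφ_im] at hcz
    exact nonneg_of_mul_nonneg_right hcz (half_pos hr)

theorem two_constants (hO : O ∈ modelRegions) (hδ : 0 < δ) (hδM : δ ≤ M)
    (hG : IsExtensionOn lineIncl O f (lineIncl x) r G) (hf : ∀ y ∈ ball x r, ‖f y‖ ≤ δ)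
    (hGM : ∀ z ∈ ball (lineIncl x) r ∩ (range lineIncl ∪ O), ‖G z‖ ≤ M)
    {z : ℂ} (hz : z ∈ ball (lineIncl x) (r / 20) ∩ (range lineIncl ∪ O)) :
    ‖G z‖ ≤ √(M * δ) := by
  obtain ⟨φ, hφ, hφ_ball, hφ_side, hφ_line, w, hw, him, rfl⟩ := exists_halfDisc_chart hO hz
  choose g hg using fun y => hφ_line (mem_range_self y)
  have hGφ : IsExtensionOn lineIncl upperSide (f ∘ g) 0 2 (G ∘ φ) :=
    hG.comp hφ.differentiableOn hφ_ball (fun w hw => hφ_side hw.2) fun y _ => ⟨g y, hg y, rfl⟩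
  refine two_constants_halfDisc hδ hδM hGφ (fun y hy => hf _ ?_) (fun v hv => ?_) hw him
  · rw [← lineIncl_mem_ball, hg]
    exact hφ_ball (lineIncl_mem_ball.2 hy)
  · exact hGM _ ⟨hφ_ball hv.1, hv.2.imp (fun h => hφ_line h) (fun h => hφ_side h)⟩

end TwoConstants

section Limits

variable {O : Set ℂ} {κ : Type*} {l : Filter κ} {f : ℝ → ℂ} {g : κ → ℝ → ℂ} {G : κ → ℂ → ℂ}
  {x r M : ℝ}

theorem uniformCauchySeqOn_of_isExtensionOn (hO : O ∈ modelRegions)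
    (hG : ∀ i, IsExtensionOn lineIncl O (g i) (lineIncl x) r (G i))
    (hGM : ∀ i, ∀ z ∈ ball (lineIncl x) r ∩ (range lineIncl ∪ O), ‖G i z‖ ≤ M)
    (hg : UniformCauchySeqOn g l (ball x r)) :
    UniformCauchySeqOn G l (ball (lineIncl x) (r / 20) ∩ (range lineIncl ∪ O)) := by
  intro V hV
  obtain ⟨ε, hε, hεV⟩ := Metric.mem_uniformity_dist.1 hV
  set M' := max (M + M) 1
  have hM' : 0 < M' := one_pos.trans_le (le_max_right _ _)
  set δ := min M' (ε ^ 2 / (2 * M'))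
  have hδ : 0 < δ := lt_min hM' (by positivity)
  have hδε : √(M' * δ) < ε := by
    rw [Real.sqrt_lt' hε]
    calc M' * δ ≤ M' * (ε ^ 2 / (2 * M')) := by gcongr; exact min_le_right _ _
      _ = ε ^ 2 / 2 := by field_simp
      _ < ε ^ 2 := half_lt_self (pow_pos hε 2)
  filter_upwards [hg _ (Metric.dist_mem_uniformity hδ)] with i hi z hz
  refine hεV (lt_of_le_of_lt ?_ hδε)
  rw [dist_eq_norm]
  refine two_constants (G := G i.1 - G i.2) hO hδ (min_le_left _ _) ((hG i.1).sub (hG i.2))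
    (fun y hy => ?_) (fun w hw => ?_) hz
  · rw [Pi.sub_apply, ← dist_eq_norm]
    exact (hi y hy).le
  · exact (norm_sub_le_of_le (hGM i.1 w hw) (hGM i.2 w hw)).trans (le_max_left _ _)

theorem extendsOn_of_tendstoUniformlyOn [l.NeBot] (hO : O ∈ modelRegions)
    (hg : ∀ i, ExtendsBoundedlyOn lineIncl O (g i) (lineIncl x) r M)
    (hgf : TendstoUniformlyOn g f l (ball x r)) :
    ExtendsOn lineIncl O f (lineIncl x) (r / 20) := by
  choose G hG hGM using hg
  have hsub : ball (lineIncl x) (r / 20) ⊆ ball (lineIncl x) r :=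
    fun z hz => ball_subset_ball (by linarith [pos_of_mem_ball hz]) hz
  have hcauchy := uniformCauchySeqOn_of_isExtensionOn hO hG hGM hgf.uniformCauchySeqOn
  have hlim (z : ℂ) (hz : z ∈ ball (lineIncl x) (r / 20) ∩ (range lineIncl ∪ O)) :
      ∃ a, Tendsto (fun i => G i z) l (𝓝 a) :=
    cauchy_iff_exists_le_nhds.1 (hcauchy.cauchy_map hz)
  choose! F hF using hlim
  have hGF := hcauchy.tendstoUniformlyOn_of_tendsto hF
  have hGr (i : κ) := (hG i).mono hsub
  refine ⟨F, hGF.continuousOn (.of_forall fun i => (hGr i).continuousOn), ?_, fun y hy => ?_⟩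
  · have hGFO := hGF.mono (inter_subset_inter_right _ subset_union_right)
    exact hGFO.tendstoLocallyUniformlyOn.differentiableOn
      (.of_forall fun i => (hGr i).differentiableOn)
      (isOpen_ball.inter (isOpen_of_mem_modelRegions hO))
  · refine tendsto_nhds_unique (hF _ ⟨hy, .inl ⟨y, rfl⟩⟩) ?_
    have hgfy := hgf.tendsto_at (lineIncl_mem_ball.1 (hsub hy))
    exact hgfy.congr fun i => ((hG i).apply_eq y (hsub hy)).symm

end Limits

section Uniqueness

variable {O : Set ℂ} {f : ℝ → ℂ} {G : ℂ → ℂ} {m x r M : ℝ}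

theorem range_lineIncl_union_subset_closure (hO : O ∈ modelRegions) :
    range lineIncl ∪ O ⊆ closure O :=
  union_subset (range_subset_iff.2 (lineIncl_mem_closure hO)) subset_closure

theorem IsExtensionOn.eqOn_zero_of_bounded (hO : O ∈ modelRegions)
    (hG : IsExtensionOn lineIncl O f (lineIncl x) r G)
    (hGM : ∀ z ∈ ball (lineIncl x) r ∩ (range lineIncl ∪ O), ‖G z‖ ≤ M)
    (hf : EqOn f 0 (ball x r)) :
    EqOn G 0 (ball (lineIncl x) (r / 20) ∩ (range lineIncl ∪ O)) := by
  intro z hz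
  have hM : 0 < max M 1 := one_pos.trans_le (le_max_right _ _)
  have hbound : ∀ᶠ δ in 𝓝[>] (0 : ℝ), ‖G z‖ ≤ √(max M 1 * δ) := by
    filter_upwards [Ioc_mem_nhdsGT hM] with δ hδ
    refine two_constants hO hδ.1 hδ.2 hG (fun y hy => ?_)
      (fun w hw => (hGM w hw).trans (le_max_left _ _)) hz
    rw [hf hy, Pi.zero_apply, norm_zero]
    exact hδ.1.le
  have hlim : Tendsto (fun δ => √(max M 1 * δ)) (𝓝[>] 0) (𝓝 0) := by
    have hcont : Continuous fun δ => √(max M 1 * δ) := by fun_prop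
    simpa only [mul_zero, Real.sqrt_zero] using (hcont.tendsto 0).mono_left nhdsWithin_le_nhds
  exact norm_le_zero_iff.1 (ge_of_tendsto hlim hbound)

theorem IsExtensionOn.exists_ball_eqOn_zero (hO : O ∈ modelRegions)
    (hG : IsExtensionOn lineIncl O f (lineIncl x) r G) (hm : m ∈ ball x r)
    (hfm : f =ᶠ[𝓝 m] 0) :
    ∃ s > 0, EqOn G 0 (ball (lineIncl m) s ∩ O) := by
  have hball : ∀ᶠ s in 𝓝[>] 0, closedBall (lineIncl m) s ⊆ ball (lineIncl x) r :=
    nhdsWithin_le_nhds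
      (eventually_closedBall_subset (isOpen_ball.mem_nhds (lineIncl_mem_ball.2 hm)))
  have hzero : ∀ᶠ s in 𝓝[>] 0, ball m s ⊆ {y | f y = 0} :=
    nhdsWithin_le_nhds (eventually_ball_subset hfm)
  obtain ⟨s, hs₀, hs, hfs⟩ := (eventually_mem_nhdsWithin.and (hball.and hzero)).exists
  obtain ⟨M, hGM⟩ := hG.exists_bound (isClosed_range_lineIncl_union hO) hs
  refine ⟨s / 20, div_pos hs₀ (by norm_num), ?_⟩
  exact ((hG.mono (ball_subset_closedBall.trans hs)).eqOn_zero_of_bounded hO hGM hfs).mono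
    (inter_subset_inter_right _ subset_union_right)

theorem IsExtensionOn.eqOn_zero (hO : O ∈ modelRegions)
    (hG : IsExtensionOn lineIncl O f (lineIncl x) r G) (hm : m ∈ ball x r)
    (hfm : f =ᶠ[𝓝 m] 0) : EqOn G 0 (ball (lineIncl x) r ∩ (range lineIncl ∪ O)) := by
  obtain ⟨s, hs, hGs⟩ := hG.exists_ball_eqOn_zero hO hm hfm
  have hopen : IsOpen (ball (lineIncl x) r ∩ O) :=
    isOpen_ball.inter (isOpen_of_mem_modelRegions hO)
  have hconn : IsPreconnected (ball (lineIncl x) r ∩ O) :=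
    ((convex_ball _ _).inter (convex_of_mem_modelRegions hO)).isPreconnected
  obtain ⟨w, ⟨hws, hwr⟩, hwO⟩ := mem_closure_iff.1 (lineIncl_mem_closure hO m) _
    (isOpen_ball.inter isOpen_ball) ⟨mem_ball_self hs, lineIncl_mem_ball.2 hm⟩
  have hGw : G =ᶠ[𝓝 w] 0 := by
    filter_upwards [(isOpen_ball.inter (isOpen_of_mem_modelRegions hO)).mem_nhds ⟨hws, hwO⟩]
      using hGs
  have hGO : EqOn G 0 (ball (lineIncl x) r ∩ O) :=
    (hG.differentiableOn.analyticOnNhd hopen).eqOn_zero_of_preconnected_of_eventuallyEq_zero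
      hconn ⟨hwr, hwO⟩ hGw
  refine hGO.of_subset_closure hG.continuousOn continuousOn_const
    (inter_subset_inter_right _ subset_union_right) ?_
  exact (inter_subset_inter_right _ (range_lineIncl_union_subset_closure hO)).trans
    isOpen_ball.inter_closure

theorem ExtendsOn.eqOn_zero (hO : O ∈ modelRegions)
    (hf : ExtendsOn lineIncl O f (lineIncl x) r) (hm : m ∈ ball x r) (hfm : f =ᶠ[𝓝 m] 0) :
    EqOn f 0 (ball x r) := by
  obtain ⟨G, hG⟩ := hf
  intro y hy
  rw [← lineIncl_mem_ball] at hy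
  rw [← hG.apply_eq y hy, hG.eqOn_zero hO hm hfm ⟨hy, .inl ⟨y, rfl⟩⟩, Pi.zero_apply, Pi.zero_apply]

end Uniqueness

section Gdelta

variable {Y : Type*} [TopologicalSpace Y] {R : Set ℝ} {Φ : Y → ℝ → ℂ} {O : Set ℂ}
  {𝒪 : Set (Set ℂ)}

/-- The functions `f : ℝ → ℂ` which extend, at no point of `R`, from any of the regions in `𝒪`. -/
def nowhereExtendable (R : Set ℝ) (𝒪 : Set (Set ℂ)) : Set (ℝ → ℂ) :=
  {f | ∀ O ∈ 𝒪, ∀ x ∈ R, ∀ r > 0, ¬ ExtendsOn lineIncl O f (lineIncl x) r}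

/-- The pairs `(q, s)` of a rational centre and a positive rational radius for which
`[q - s, q + s] ⊆ R`. -/
def rationalIntervals (R : Set ℝ) : Set (ℚ × ℚ) :=
  {p | 0 < p.2 ∧ closedBall (p.1 : ℝ) p.2 ⊆ R}

/-- Uniform convergence on the compact subsets of `R`, for a family of functions `Φ y : ℝ → ℂ`
depending on a parameter `y`. -/
def ContinuousCompactlyOn (R : Set ℝ) (Φ : Y → ℝ → ℂ) : Prop :=
  Continuous fun y => UniformOnFun.ofFun {K | IsCompact K ∧ K ⊆ R} (Φ y)

theorem ContinuousCompactlyOn.tendstoUniformlyOn (hΦ : ContinuousCompactlyOn R Φ) (y : Y)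
    {K : Set ℝ} (hK : IsCompact K) (hKR : K ⊆ R) : TendstoUniformlyOn Φ (Φ y) (𝓝 y) K :=
  UniformOnFun.tendsto_iff_tendstoUniformlyOn.1 (hΦ.tendsto y) K ⟨hK, hKR⟩

theorem ContinuousCompactlyOn.extendsOn_of_mem_closure (hΦ : ContinuousCompactlyOn R Φ)
    (hO : O ∈ modelRegions) {x r M : ℝ} (hR : closedBall x r ⊆ R) {y : Y}
    (hy : y ∈ closure {y | ExtendsBoundedlyOn lineIncl O (Φ y) (lineIncl x) r M}) :
    ExtendsOn lineIncl O (Φ y) (lineIncl x) (r / 20) := by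
  rw [mem_closure_iff_comap_neBot] at hy
  have hlim := (hΦ.tendstoUniformlyOn y (isCompact_closedBall x r) hR).mono ball_subset_closedBall
  have hbdd (z : {y | ExtendsBoundedlyOn lineIncl O (Φ y) (lineIncl x) r M}) :
      ExtendsBoundedlyOn lineIncl O (Φ z) (lineIncl x) r M := z.2
  exact extendsOn_of_tendstoUniformlyOn hO hbdd fun V hV => tendsto_comap.eventually (hlim V hV)

theorem exists_rationalInterval (hR : IsOpen R) {x r : ℝ} (hx : x ∈ R) (hr : 0 < r) :
    ∃ p ∈ rationalIntervals R, closedBall (lineIncl p.1) p.2 ⊆ ball (lineIncl x) r := by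
  obtain ⟨ρ, hρ, hρR⟩ := Metric.isOpen_iff.1 hR x hx
  obtain ⟨s, hs₀, hs⟩ := exists_rat_btwn (half_pos (lt_min hρ hr))
  obtain ⟨q, hq⟩ := Rat.denseRange_cast.exists_dist_lt x hs₀
  have hball {ε : ℝ} (hε : min ρ r ≤ ε) : s + dist (q : ℝ) x < ε := by
    rw [dist_comm]
    linarith
  refine ⟨(q, s), ⟨Rat.cast_pos.1 hs₀, ?_⟩, closedBall_subset_ball' ?_⟩
  · exact (closedBall_subset_ball' (hball (min_le_left _ _))).trans hρR
  · rw [lineIncl, lineIncl, Complex.isometry_ofReal.dist_eq]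
    exact hball (min_le_right _ _)

theorem ContinuousCompactlyOn.setOf_mem_nowhereExtendable (hΦ : ContinuousCompactlyOn R Φ)
    (hR : IsOpen R) (h𝒪 : 𝒪 ⊆ modelRegions) :
    {y | Φ y ∈ nowhereExtendable R 𝒪} = ⋂ O ∈ 𝒪, ⋂ p ∈ rationalIntervals R, ⋂ M : ℕ,
      (closure {y | ExtendsBoundedlyOn lineIncl O (Φ y) (lineIncl p.1) p.2 M})ᶜ := by
  ext y
  simp only [mem_iInter]
  refine ⟨fun hy O hO p hp M hyM => ?_, fun hy O hO x hx r hr hyr => ?_⟩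
  · have hp₀ : (0 : ℝ) < p.2 := Rat.cast_pos.2 hp.1
    exact hy O hO p.1 (hp.2 (mem_closedBall_self hp₀.le)) _ (div_pos hp₀ (by norm_num))
      (hΦ.extendsOn_of_mem_closure (h𝒪 hO) hp.2 hyM)
  · obtain ⟨p, hp, hpr⟩ := exists_rationalInterval hR hx hr
    obtain ⟨M, hM⟩ :=
      hyr.exists_extendsBoundedlyOn (isClosed_range_lineIncl_union (h𝒪 hO)) hpr
    exact hy O hO p hp M (subset_closure hM)

theorem ContinuousCompactlyOn.isGδ_setOf_mem_nowhereExtendable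
    (hΦ : ContinuousCompactlyOn R Φ) (hR : IsOpen R) (h𝒪 : 𝒪 ⊆ modelRegions) :
    IsGδ {y | Φ y ∈ nowhereExtendable R 𝒪} := by
  rw [hΦ.setOf_mem_nowhereExtendable hR h𝒪]
  exact .biInter (countable_modelRegions.mono h𝒪) fun O _ =>
    .biInter (to_countable _) fun p _ => .iInter_of_isOpen fun M => isClosed_closure.isOpen_compl

end Gdelta

section Jets

variable {R : Set ℝ}

/-- The Fréchet space of the smooth functions on `ℝ` all of whose derivatives tend to `0` at
infinity and vanish off `R`. A function is encoded as the sequence of its derivatives, so that the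
topology is the one of the seminorms `sup |f^(l)|`. -/
def decayingJets (R : Set ℝ) : Submodule ℝ (ℕ → C₀(ℝ, ℂ)) where
  carrier := {F | (∀ l x, HasDerivAt (F l) (F (l + 1) x) x) ∧ ∀ l, ∀ x ∉ R, F l x = 0}
  zero_mem' := ⟨fun _ x => hasDerivAt_const x 0, fun _ _ _ => rfl⟩
  add_mem' hF hG := ⟨fun l x => (hF.1 l x).add (hG.1 l x), fun l x hx => by
    rw [Pi.add_apply, ZeroAtInftyContinuousMap.add_apply, hF.2 l x hx, hG.2 l x hx, add_zero]⟩
  smul_mem' c F hF := ⟨fun l x => (hF.1 l x).const_smul c, fun l x hx => by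
    rw [Pi.smul_apply, ZeroAtInftyContinuousMap.smul_apply, hF.2 l x hx, smul_zero]⟩

theorem isClosed_decayingJets (R : Set ℝ) :
    IsClosed (decayingJets R : Set (ℕ → C₀(ℝ, ℂ))) := by
  refine IsSeqClosed.isClosed fun F G hF hFG => ?_
  have hlim (l : ℕ) : TendstoUniformly (fun n => ⇑(F n l)) (G l) atTop :=
    ZeroAtInftyContinuousMap.tendsto_iff_tendstoUniformly.1 (hFG.apply_nhds l)
  refine ⟨fun l => hasDerivAt_of_tendstoUniformly (hlim (l + 1))
    (.of_forall fun n => (hF n).1 l) fun x => (hlim l).tendsto_at x, fun l x hx => ?_⟩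
  refine tendsto_nhds_unique ((hlim l).tendsto_at x) (tendsto_const_nhds.congr fun n => ?_)
  exact ((hF n).2 l x hx).symm

instance baireSpace_decayingJets (R : Set ℝ) : BaireSpace (decayingJets R) :=
  have := (isClosed_decayingJets R).isCompletelyPseudoMetrizableSpace
  BaireSpace.of_completelyPseudoMetrizable

theorem tendstoUniformly_jet {κ : Type*} {𝓕 : Filter κ} {F : κ → decayingJets R}
    {G : decayingJets R} (hF : Tendsto F 𝓕 (𝓝 G)) (l : ℕ) :
    TendstoUniformly (fun i => ⇑((F i : ℕ → C₀(ℝ, ℂ)) l)) (G.1 l) 𝓕 :=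
  ZeroAtInftyContinuousMap.tendsto_iff_tendstoUniformly.1
    (((continuous_apply l).comp continuous_subtype_val).tendsto G |>.comp hF)

theorem iteratedDeriv_jet (F : decayingJets R) (l : ℕ) : iteratedDeriv l (F.1 0) = F.1 l := by
  induction l with
  | zero => exact iteratedDeriv_zero
  | succ l ih => rw [iteratedDeriv_succ, ih]; exact funext fun x => (F.2.1 l x).deriv

theorem contDiff_jet (F : decayingJets R) : ContDiff ℝ ∞ (F.1 0) := by
  refine contDiff_of_differentiable_iteratedDeriv fun l _ => ?_
  rw [iteratedDeriv_jet]
  exact fun x => (F.2.1 l x).differentiableAt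

theorem tsupport_iteratedDeriv_subset {𝕜 E : Type*} [NontriviallyNormedField 𝕜]
    [NormedAddCommGroup E] [NormedSpace 𝕜 E] (f : 𝕜 → E) (l : ℕ) :
    tsupport (iteratedDeriv l f) ⊆ tsupport f := by
  induction l with
  | zero => rw [iteratedDeriv_zero]
  | succ l ih =>
    rw [iteratedDeriv_succ]
    exact tsupport_deriv_subset.trans ih

theorem exists_jet_eq {f : ℝ → ℂ} (hf : ContDiff ℝ ∞ f) (hfc : HasCompactSupport f)
    (hfR : tsupport f ⊆ R) : ∃ F : decayingJets R, ⇑(F.1 0) = f := by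
  have hcont (l : ℕ) : Continuous (iteratedDeriv l f) :=
    hf.continuous_iteratedDeriv l (mod_cast le_top)
  have hcomp (l : ℕ) : HasCompactSupport (iteratedDeriv l f) :=
    hfc.mono' (subset_closure.trans (tsupport_iteratedDeriv_subset f l))
  refine ⟨⟨fun l => ⟨⟨iteratedDeriv l f, hcont l⟩, (hcomp l).is_zero_at_infty⟩,
    fun l x => ?_, fun l x hx => ?_⟩, iteratedDeriv_zero⟩
  · change HasDerivAt (iteratedDeriv l f) (iteratedDeriv (l + 1) f x) x
    rw [iteratedDeriv_succ]
    exact (hf.differentiable_iteratedDeriv l (mod_cast ENat.natCast_lt_top l) x).hasDerivAt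
  · exact image_eq_zero_of_notMem_tsupport fun h => hx (hfR (tsupport_iteratedDeriv_subset f l h))

theorem exists_jet_not_extendsOn (hR : IsOpen R) {x r : ℝ} (hx : x ∈ R) (hr : 0 < r) :
    ∃ F : decayingJets R, ∀ O ∈ modelRegions, ¬ ExtendsOn lineIncl O (F.1 0) (lineIncl x) r := by
  obtain ⟨ψ, hψs, hψc, hψ, -, hψx⟩ := exists_contDiff_tsupport_subset (n := ⊤)
    (Filter.inter_mem (hR.mem_nhds hx) (closedBall_mem_nhds x (half_pos hr)))
  have hsupp : tsupport (fun y => (ψ y : ℂ)) ⊆ tsupport ψ :=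
    closure_mono (Function.support_comp_subset Complex.ofReal_zero ψ)
  obtain ⟨F, hF⟩ := exists_jet_eq (f := fun y => (ψ y : ℂ)) (Complex.ofRealCLM.contDiff.comp hψ)
    (hψc.comp_left Complex.ofReal_zero) (hsupp.trans (hψs.trans inter_subset_left))
  refine ⟨F, fun O hO hext => ?_⟩
  rw [hF] at hext
  obtain ⟨m, hm, hmψ⟩ : ∃ m ∈ ball x r, m ∉ tsupport ψ := by
    refine ⟨x + 3 / 4 * r, ?_, fun h => ?_⟩
    · rw [mem_ball_iff_norm, add_sub_cancel_left, Real.norm_of_nonneg (by positivity)]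
      linarith
    · have h' := (hψs h).2
      rw [mem_closedBall_iff_norm, add_sub_cancel_left, Real.norm_of_nonneg (by positivity)] at h'
      linarith
  have hzero : (fun y => (ψ y : ℂ)) =ᶠ[𝓝 m] 0 :=
    notMem_tsupport_iff_eventuallyEq.1 fun h => hmψ (hsupp h)
  have hx₀ : (ψ x : ℂ) = 0 := hext.eqOn_zero hO hm hzero (mem_ball_self hr)
  rw [hψx, Complex.ofReal_one] at hx₀
  exact one_ne_zero hx₀

end Jets

section JetPerturbations

variable {R : Set ℝ} {O : Set ℂ}

theorem continuousCompactlyOn_add_jet (f : ℝ → ℂ) :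
    ContinuousCompactlyOn R fun (F : decayingJets R) y => f y + F.1 0 y := by
  refine continuous_iff_continuousAt.2 fun F => ?_
  refine UniformOnFun.tendsto_iff_tendstoUniformlyOn.2 fun K _ => ?_
  have hconst : TendstoUniformlyOn (fun _ : decayingJets R => f) f (𝓝 F) K :=
    fun _ hV => .of_forall fun _ _ _ => refl_mem_uniformity hV
  exact hconst.add (tendstoUniformly_jet tendsto_id 0).tendstoUniformlyOn

theorem dense_compl_closure_extendsBoundedlyOn_add_jet (hR : IsOpen R) (hO : O ∈ modelRegions)
    (f : ℝ → ℂ) {x r M : ℝ} (hr : 0 < r) (hxr : closedBall x r ⊆ R) :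
    Dense (closure {F : decayingJets R | ExtendsBoundedlyOn lineIncl O (fun y => f y + F.1 0 y)
      (lineIncl x) r M})ᶜ := by
  rw [← interior_eq_empty_iff_dense_compl, eq_empty_iff_forall_notMem]
  intro F hF
  obtain ⟨E, hE⟩ := exists_jet_not_extendsOn hR (hxr (mem_closedBall_self hr.le))
    (div_pos hr (by norm_num : (0 : ℝ) < 20))
  have hext (G : decayingJets R) :=
    (continuousCompactlyOn_add_jet f).extendsOn_of_mem_closure hO hxr (M := M) (y := G)
  have hpath : Tendsto (fun ε : ℝ => F + ε • E) (𝓝[≠] 0) (𝓝 F) := by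
    have hcont : Continuous fun ε : ℝ => F + ε • E := continuous_induced_rng.2 <|
      continuous_pi fun l => continuous_const.add (continuous_id.smul continuous_const)
    simpa only [zero_smul, add_zero] using (hcont.tendsto 0).mono_left nhdsWithin_le_nhds
  obtain ⟨ε, hεF, hε⟩ :=
    ((hpath.eventually (isOpen_interior.mem_nhds hF)).and eventually_mem_nhdsWithin).exists
  refine hE O hO ?_
  convert ((hext _ (interior_subset hεF)).sub (hext _ (interior_subset hF))).const_smul (ε⁻¹ : ℂ)
    using 1
  ext y
  have hε' : (ε : ℂ) ≠ 0 := Complex.ofReal_ne_zero.2 hε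
  change E.1 0 y = (ε : ℂ)⁻¹ * (f y + (F.1 0 y + ε • E.1 0 y) - (f y + F.1 0 y))
  rw [Complex.real_smul]
  field_simp
  ring

theorem dense_setOf_add_jet_mem_nowhereExtendable (hR : IsOpen R) (f : ℝ → ℂ) :
    Dense {F : decayingJets R | (fun y => f y + F.1 0 y) ∈ nowhereExtendable R modelRegions} := by
  rw [(continuousCompactlyOn_add_jet f).setOf_mem_nowhereExtendable hR subset_rfl]
  refine dense_biInter_of_Gδ (fun O _ => ?_) countable_modelRegions fun O hO => ?_
  · exact .biInter (to_countable _) fun p _ => .iInter_of_isOpen fun M =>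
      isClosed_closure.isOpen_compl
  · refine dense_biInter_of_Gδ (fun p _ => ?_) (to_countable _) fun p hp => ?_
    · exact .iInter_of_isOpen fun M => isClosed_closure.isOpen_compl
    · exact dense_iInter_of_isOpen (fun M => isClosed_closure.isOpen_compl) fun M =>
        dense_compl_closure_extendsBoundedlyOn_add_jet hR hO f (Rat.cast_pos.2 hp.1) hp.2

end JetPerturbations

section Perturbation

variable {X : Type} {t : X → ℝ} {k : ℕ∞}

theorem inCoord_apply (ht : Function.Injective t) (u : X → ℂ) (x : X) :
    inCoord t u (t x) = u x :=
  ht.extend_apply u 0 x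

theorem inCoord_add_jet (ht : Function.Injective t) (u : X → ℂ) (F : decayingJets (range t)) :
    inCoord t (fun x => u x + F.1 0 (t x)) = fun y => inCoord t u y + F.1 0 y := by
  funext y
  by_cases hy : y ∈ range t
  · obtain ⟨x, rfl⟩ := hy
    simp only [inCoord_apply ht]
  · simp only [inCoord, Function.extend_apply' _ _ _ hy, F.2.2 0 y hy, add_zero]

theorem Ckb.tendsto_iff {κ : Type*} {𝓕 : Filter κ} {p : κ → Ckb t k} {u : Ckb t k} :
    Tendsto p 𝓕 (𝓝 u) ↔ ∀ l : ℕ, (l : ℕ∞) ≤ k →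
      TendstoUniformly (fun i => curveDeriv t l (p i).toFun) (curveDeriv t l u.toFun) 𝓕 := by
  simp only [nhds_iInf, nhds_induced, tendsto_iInf, tendsto_comap_iff,
    UniformFun.tendsto_iff_tendstoUniformly]
  rfl

variable [TopologicalSpace X]

theorem Ck.tendsto_iff {κ : Type*} {𝓕 : Filter κ} {p : κ → Ck t k} {u : Ck t k} :
    Tendsto p 𝓕 (𝓝 u) ↔ ∀ l : ℕ, (l : ℕ∞) ≤ k → ∀ K : Set X, IsCompact K →
      TendstoUniformlyOn (fun i => curveDeriv t l (p i).toFun) (curveDeriv t l u.toFun) 𝓕 K := by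
  simp only [nhds_iInf, nhds_induced, tendsto_iInf, tendsto_comap_iff,
    UniformOnFun.tendsto_iff_tendstoUniformlyOn]
  rfl

theorem Ckb.continuous_toCk : Continuous (Ckb.toCk : Ckb t k → Ck t k) :=
  continuous_iff_continuousAt.2 fun _ => Ck.tendsto_iff.2 fun l hl _ _ =>
    (Ckb.tendsto_iff.1 tendsto_id l hl).tendstoUniformlyOn

theorem Ck0.continuous_toCkb : Continuous (Ck0.toCkb : Ck0 t k → Ckb t k) :=
  continuous_induced_dom

theorem continuousCompactlyOn_inCoord (ht : IsOpenEmbedding t) (k : ℕ∞) :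
    ContinuousCompactlyOn (range t) fun u : Ck t k => inCoord t u.toFun := by
  refine continuous_iff_continuousAt.2 fun u => ?_
  refine UniformOnFun.tendsto_iff_tendstoUniformlyOn.2 fun K ⟨hK, hKt⟩ V hV => ?_
  have hK' : IsCompact (t ⁻¹' K) := by
    rwa [ht.isInducing.isCompact_iff, image_preimage_eq_of_subset hKt]
  filter_upwards [Ck.tendsto_iff.1 tendsto_id 0 bot_le _ hK' V hV] with v hv y hy
  obtain ⟨x, rfl⟩ := hKt hy
  have hvx : (curveDeriv t 0 u.toFun x, curveDeriv t 0 v.toFun x) ∈ V := hv x hy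
  simp only [curveDeriv, iteratedDeriv_zero] at hvx
  exact hvx

/-- The perturbation of a function of class `C^k` on the curve by a decaying smooth function of the
coordinate. -/
noncomputable def Ck.addJet (ht : IsOpenEmbedding t) (u : Ck t k)
    (F : decayingJets (range t)) : Ck t k where
  toFun x := u.toFun x + F.1 0 (t x)
  contDiff := by
    rw [inCoord_add_jet ht.injective]
    exact u.contDiff.add ((contDiff_jet F).of_le (mod_cast le_top)).contDiffOn

theorem Ck.curveDeriv_addJet (ht : IsOpenEmbedding t) (u : Ck t k) (F : decayingJets (range t))
    {l : ℕ} (hl : (l : ℕ∞) ≤ k) (x : X) :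
    curveDeriv t l (u.addJet ht F).toFun x = curveDeriv t l u.toFun x + F.1 l (t x) := by
  have hu : ContDiffAt ℝ l (inCoord t u.toFun) (t x) :=
    (u.contDiff.contDiffAt (ht.isOpen_range.mem_nhds (mem_range_self x))).of_le (mod_cast hl)
  have hF : ContDiffAt ℝ l (F.1 0) (t x) := (contDiff_jet F).contDiffAt.of_le (mod_cast le_top)
  simp only [curveDeriv, addJet, inCoord_add_jet ht.injective]
  rw [iteratedDeriv_fun_add hu hF, iteratedDeriv_jet]

theorem Ck.tendstoUniformly_curveDeriv_addJet (ht : IsOpenEmbedding t) (u : Ck t k) {l : ℕ}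
    (hl : (l : ℕ∞) ≤ k) :
    TendstoUniformly (fun F => curveDeriv t l (u.addJet ht F).toFun) (curveDeriv t l u.toFun)
      (𝓝 0) := by
  have hconst : TendstoUniformly (fun _ : decayingJets (range t) => curveDeriv t l u.toFun)
      (curveDeriv t l u.toFun) (𝓝 0) := fun _ hV => .of_forall fun _ _ => refl_mem_uniformity hV
  convert hconst.add ((tendstoUniformly_jet tendsto_id l).comp t) using 1
  · funext F x
    exact u.curveDeriv_addJet ht F hl x
  · exact funext fun x => (add_zero _).symm

theorem tendsto_jet_cocompact (ht : IsOpenEmbedding t) (F : decayingJets (range t)) (l : ℕ) :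
    Tendsto (fun x => F.1 l (t x)) (cocompact X) (𝓝 0) := by
  refine Metric.tendsto_nhds.2 fun ε hε => ?_
  have hK : IsCompact {y | ε ≤ dist (F.1 l y) 0} := by
    obtain ⟨K, hK, hKε⟩ := mem_cocompact.1
      ((zero_at_infty (F.1 l)).eventually (ball_mem_nhds 0 hε))
    refine hK.of_isClosed_subset (isClosed_le continuous_const (by fun_prop)) fun y hy => ?_
    exact by_contra fun hyK => not_lt_of_ge hy (mem_ball.1 (hKε hyK))
  have hKt : {y | ε ≤ dist (F.1 l y) 0} ⊆ range t := fun y hy => by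
    by_contra hyt
    rw [mem_ofPred_eq, F.2.2 l y hyt, dist_self] at hy
    exact hε.not_ge hy
  have hK' : IsCompact (t ⁻¹' {y | ε ≤ dist (F.1 l y) 0}) := by
    rwa [ht.isInducing.isCompact_iff, image_preimage_eq_of_subset hKt]
  filter_upwards [hK'.compl_mem_cocompact] with x hx using not_le.1 hx

/-- The perturbation of an element of `C_b^k` by a decaying smooth function of the coordinate. -/
noncomputable def Ckb.addJet (ht : IsOpenEmbedding t) (u : Ckb t k) (F : decayingJets (range t)) :
    Ckb t k where
  toCk := u.toCk.addJet ht F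
  bounded l hl := by
    obtain ⟨C, hC⟩ := u.bounded l hl
    refine ⟨C + ‖(F.1 l).toBCF‖, fun x => ?_⟩
    rw [u.toCk.curveDeriv_addJet ht F hl]
    exact (norm_add_le _ _).trans (add_le_add (hC x) ((F.1 l).toBCF.norm_coe_le_norm (t x)))

/-- The perturbation of an element of `C_0^k` by a decaying smooth function of the coordinate. -/
noncomputable def Ck0.addJet (ht : IsOpenEmbedding t) (u : Ck0 t k) (F : decayingJets (range t)) :
    Ck0 t k where
  toCkb := u.toCkb.addJet ht F
  vanishing l hl := by
    have h := (u.vanishing l hl).add (tendsto_jet_cocompact ht F l)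
    rw [add_zero] at h
    exact h.congr fun x => (u.toCk.curveDeriv_addJet ht F hl x).symm

theorem Ck.tendsto_addJet (ht : IsOpenEmbedding t) (u : Ck t k) :
    Tendsto (u.addJet ht) (𝓝 0) (𝓝 u) :=
  Ck.tendsto_iff.2 fun _ hl _ _ =>
    (u.tendstoUniformly_curveDeriv_addJet ht hl).tendstoUniformlyOn

theorem Ckb.tendsto_addJet (ht : IsOpenEmbedding t) (u : Ckb t k) :
    Tendsto (u.addJet ht) (𝓝 0) (𝓝 u) :=
  Ckb.tendsto_iff.2 fun _ hl => u.toCk.tendstoUniformly_curveDeriv_addJet ht hl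

theorem Ck0.tendsto_addJet (ht : IsOpenEmbedding t) (u : Ck0 t k) :
    Tendsto (u.addJet ht) (𝓝 0) (𝓝 u) := by
  rw [nhds_induced (Ck0.toCkb : Ck0 t k → Ckb t k), tendsto_comap_iff]
  exact u.toCkb.tendsto_addJet ht

theorem Ck.frequently_addJet_mem_nowhereExtendable (ht : IsOpenEmbedding t) (u : Ck t k) :
    ∃ᶠ F in 𝓝 0, inCoord t (u.addJet ht F).toFun ∈ nowhereExtendable (range t) modelRegions := by
  simp only [addJet, inCoord_add_jet ht.injective]
  exact mem_closure_iff_frequently.1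
    (dense_setOf_add_jet_mem_nowhereExtendable ht.isOpen_range _ 0)

theorem nowhereExtendable_anti {R : Set ℝ} {𝒪 𝒪' : Set (Set ℂ)} (h : 𝒪 ⊆ 𝒪') :
    nowhereExtendable R 𝒪' ⊆ nowhereExtendable R 𝒪 :=
  fun _ hf O hO => hf O (h hO)

theorem denseGdeltaInSpaces_nowhereExtendable (ht : IsOpenEmbedding t) (k : ℕ∞)
    {𝒪 : Set (Set ℂ)} (h𝒪 : 𝒪 ⊆ modelRegions) :
    DenseGdeltaInSpaces t k {u | inCoord t u ∈ nowhereExtendable (range t) 𝒪} := by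
  have hGδ : IsGδ {u : Ck t k | inCoord t u.toFun ∈ nowhereExtendable (range t) 𝒪} :=
    (continuousCompactlyOn_inCoord ht k).isGδ_setOf_mem_nowhereExtendable ht.isOpen_range h𝒪
  have hGδb : IsGδ {u : Ckb t k | inCoord t u.toFun ∈ nowhereExtendable (range t) 𝒪} :=
    IsGδ.preimage (f := Ckb.toCk) Ckb.continuous_toCk hGδ
  have hfreq (u : Ck t k) : ∃ᶠ F in 𝓝 0,
      inCoord t (u.addJet ht F).toFun ∈ nowhereExtendable (range t) 𝒪 :=
    (u.frequently_addJet_mem_nowhereExtendable ht).mono fun _ hF => nowhereExtendable_anti h𝒪 hF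
  refine ⟨⟨fun u => ?_, hGδ⟩, ⟨fun u => ?_, hGδb⟩,
    ⟨fun u => ?_, IsGδ.preimage (f := Ck0.toCkb) Ck0.continuous_toCkb hGδb⟩⟩
  · exact mem_closure_iff_frequently.2 ((u.tendsto_addJet ht).frequently (hfreq u))
  · exact mem_closure_iff_frequently.2 ((u.tendsto_addJet ht).frequently (hfreq u.toCk))
  · exact mem_closure_iff_frequently.2 ((u.tendsto_addJet ht).frequently (hfreq u.toCk))

end Perturbation

section LocalExtensions

theorem ExtendsOn.comp_of_analyticAt {X Y : Type*} {ι : X → ℂ} {κ : Y → ℂ} {S T : Set ℂ}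
    {u : X → ℂ} {v : Y → ℂ} {φ : ℂ → ℂ} {w₀ : ℂ} {r : ℝ} (hu : ExtendsOn ι S u (φ w₀) r)
    (hr : 0 < r) (hφ : AnalyticAt ℂ φ w₀) (hside : ∀ᶠ w in 𝓝 w₀, w ∈ T → φ w ∈ S)
    (hcurve : ∀ᶠ w in 𝓝 w₀, ∀ y, κ y = w → ∃ x, ι x = φ w ∧ u x = v y) :
    ∃ s > 0, ExtendsOn κ T v w₀ s := by
  obtain ⟨F, hF⟩ := hu
  have hball : ∀ᶠ w in 𝓝 w₀, φ w ∈ ball (φ w₀) r :=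
    hφ.continuousAt.eventually (ball_mem_nhds _ hr)
  obtain ⟨s, hs, h⟩ := Metric.eventually_nhds_iff_ball.1
    (hφ.eventually_analyticAt.and (hball.and (hside.and hcurve)))
  exact ⟨s, hs, F ∘ φ, hF.comp (fun w hw => (h w hw).1.differentiableAt.differentiableWithinAt)
    (fun w hw => (h w hw).2.1) (fun w hw => (h w hw.1).2.2.1 hw.2)
    fun y hy => (h _ hy).2.2.2 y rfl⟩

variable {X : Type} {ι : X → ℂ} {S : Set ℂ} {u : X → ℂ} {z₀ : ℂ}

theorem extendsToDiscAt_iff : ExtendsToDiscAt ι u z₀ ↔ ∃ r > 0, ExtendsOn ι univ u z₀ r := by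
  refine exists_congr fun r => and_congr_right fun _ => exists_congr fun F => ⟨fun hF => ?_,
    fun hF => ⟨?_, hF.apply_eq⟩⟩
  · exact ⟨hF.1.continuousOn.mono inter_subset_left, hF.1.mono inter_subset_left, hF.2⟩
  · simpa only [inter_univ] using hF.differentiableOn

variable [TopologicalSpace X]

theorem continuousOn_extend_range (hι : IsEmbedding ι) (hu : Continuous u) :
    ContinuousOn (Function.extend ι u 0) (range ι) := by
  rintro _ ⟨x, rfl⟩
  rw [ContinuousWithinAt, ← hι.isInducing.map_nhds_eq, hι.injective.extend_apply, tendsto_map'_iff,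
    Function.extend_comp hι.injective]
  exact hu.tendsto x

/-- Inside a smaller disc the given extension is kept; the function `u` on the curve provides the
continuation outside of it. -/
theorem IsExtensionOn.extendsFromSideAt (hι : IsEmbedding ι) (hu : Continuous u) {r : ℝ}
    (hr : 0 < r) {G : ℂ → ℂ} (hG : IsExtensionOn ι S u z₀ r G) : ExtendsFromSideAt ι S u z₀ := by
  classical
  set B := ball z₀ (r / 2)
  have hB : B ⊆ ball z₀ r := ball_subset_ball (half_le_self hr.le)
  set F : ℂ → ℂ := B.piecewise G (Function.extend ι u 0)
  have hFG : EqOn F G (ball z₀ r ∩ (range ι ∪ B ∩ S)) := by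
    rintro w ⟨hw, hwS⟩
    by_cases hwB : w ∈ B
    · exact piecewise_eq_of_mem _ _ _ hwB
    · obtain ⟨x, rfl⟩ := hwS.resolve_right fun h => hwB h.1
      refine (piecewise_eq_of_notMem _ _ _ hwB).trans ?_
      rw [hι.injective.extend_apply, hG.apply_eq x hw]
  have hnear : ContinuousOn F (ball z₀ r ∩ (range ι ∪ B ∩ S)) :=
    (hG.continuousOn.mono (inter_subset_inter_right _
      (union_subset_union_right _ inter_subset_right))).congr hFG
  have hfar : ContinuousOn F (Bᶜ ∩ (range ι ∪ B ∩ S)) :=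
    ((continuousOn_extend_range hι hu).mono fun w hw => hw.2.resolve_right fun h => hw.1 h.1).congr
      fun w hw => piecewise_eq_of_notMem _ _ _ hw.1
  refine ⟨r / 2, half_pos hr, F, continuousOn_of_locally_continuousOn fun w _ => ?_, ?_, ?_⟩
  · by_cases hw : w ∈ ball z₀ r
    · exact ⟨_, isOpen_ball, hw, inter_comm (ball z₀ r) _ ▸ hnear⟩
    · refine ⟨(closedBall z₀ (r / 2))ᶜ, isClosed_closedBall.isOpen_compl,
        fun h => hw (closedBall_subset_ball (half_lt_self hr) h), hfar.mono fun y hy => ?_⟩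
      exact ⟨fun hyB => hy.2 (ball_subset_closedBall hyB), hy.1⟩
  · exact (hG.differentiableOn.mono (inter_subset_inter_left _ hB)).congr
      fun w hw => hFG ⟨hB hw.1, .inr hw⟩
  · exact fun x hx => (hFG ⟨hB hx, .inl (mem_range_self x)⟩).trans (hG.apply_eq x (hB hx))

theorem extendsFromSideAt_iff (hι : IsEmbedding ι) (hu : Continuous u) :
    ExtendsFromSideAt ι S u z₀ ↔ ∃ r > 0, ExtendsOn ι S u z₀ r := by
  refine ⟨fun ⟨r, hr, F, hFc, hFd, hFu⟩ => ⟨r, hr, F, hFc.mono ?_, hFd, hFu⟩,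
    fun ⟨r, hr, G, hG⟩ => hG.extendsFromSideAt hι hu hr⟩
  rintro w ⟨hw, hwι | hwS⟩
  exacts [.inl hwι, .inr ⟨hw, hwS⟩]

end LocalExtensions

section AnalyticCurves

variable {X : Type} [TopologicalSpace X] {t : X → ℝ} {ι : X → ℂ} {e : ℂ → ℂ} {k : ℕ∞}

/-- The curve `X`, with coordinate `t` and inclusion `ι` in the plane, is an embedded analytic
curve: in the coordinate `t` the inclusion is the restriction to the real axis of the chart `e`,
which is holomorphic and locally injective near each point. -/
structure IsAnalyticCurve (t : X → ℝ) (ι : X → ℂ) (e : ℂ → ℂ) : Prop where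
  isOpenEmbedding : IsOpenEmbedding t
  isEmbedding : IsEmbedding ι
  incl_eq : ∀ x, ι x = e (lineIncl (t x))
  analyticAt : ∀ x, AnalyticAt ℂ e (lineIncl (t x))
  deriv_ne_zero : ∀ x, deriv e (lineIncl (t x)) ≠ 0

/-- Near the points of the curve, the chart `e` maps the region `O` of the plane to the side `S`
and its complement to the complement of `S`. -/
def IsSideInChart (t : X → ℝ) (e : ℂ → ℂ) (S O : Set ℂ) : Prop :=
  ∀ x, ∀ᶠ z in 𝓝 (lineIncl (t x)), e z ∈ S ↔ z ∈ O

namespace IsAnalyticCurve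

variable {S S' O O' : Set ℂ} {u : X → ℂ} {x : X} {r : ℝ}

theorem exists_extendsOn_inCoord (h : IsAnalyticCurve t ι e) (hS : IsSideInChart t e S O)
    (hr : 0 < r) (hu : ExtendsOn ι S u (ι x) r) :
    ∃ s > 0, ExtendsOn lineIncl O (inCoord t u) (lineIncl (t x)) s := by
  rw [h.incl_eq] at hu
  refine hu.comp_of_analyticAt hr (h.analyticAt x) ((hS x).mono fun z => Iff.mpr) ?_
  have hrange : ∀ᶠ y in 𝓝 (t x), y ∈ range t :=
    h.isOpenEmbedding.isOpen_range.mem_nhds (mem_range_self x)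
  rw [Complex.isometry_ofReal.isEmbedding.isInducing.nhds_eq_comap, eventually_comap] at hrange
  refine hrange.mono fun z hz y hyz => ?_
  obtain ⟨x', rfl⟩ := hz y hyz
  exact ⟨x', by rw [h.incl_eq, hyz], (inCoord_apply h.isOpenEmbedding.injective u x').symm⟩

theorem exists_extendsOn_of_inCoord (h : IsAnalyticCurve t ι e) (hS : IsSideInChart t e S O)
    (hr : 0 < r) (hu : ExtendsOn lineIncl O (inCoord t u) (lineIncl (t x)) r) :
    ∃ s > 0, ExtendsOn ι S u (ι x) s := by
  have he := (h.analyticAt x).hasStrictDerivAt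
  set L := he.localInverse _ _ _ (h.deriv_ne_zero x)
  have hL : AnalyticAt ℂ L (ι x) :=
    h.incl_eq x ▸ (h.analyticAt x).analyticAt_localInverse (h.deriv_ne_zero x)
  have hLx : L (ι x) = lineIncl (t x) :=
    h.incl_eq x ▸ (he.eventually_left_inverse (h.deriv_ne_zero x)).self_of_nhds
  have heL : ∀ᶠ w in 𝓝 (ι x), e (L w) = w :=
    h.incl_eq x ▸ he.eventually_right_inverse (h.deriv_ne_zero x)
  have hLt : ∀ᶠ w in 𝓝 (ι x), ∀ y, ι y = w → L (ι y) = lineIncl (t y) := by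
    have hcont : Continuous fun y => lineIncl (t y) :=
      Complex.continuous_ofReal.comp h.isOpenEmbedding.continuous
    have hev := (hcont.tendsto x).eventually (he.eventually_left_inverse (h.deriv_ne_zero x))
    simp only [← h.incl_eq] at hev
    rwa [h.isEmbedding.isInducing.nhds_eq_comap, eventually_comap] at hev
  rw [← hLx] at hu
  have hLS : ∀ᶠ w in 𝓝 (ι x), e (L w) ∈ S ↔ L w ∈ O :=
    hL.continuousAt.tendsto.eventually (hLx ▸ hS x)
  refine hu.comp_of_analyticAt hr hL ?_ (hLt.mono fun w hw y hy => ⟨t y, ?_, ?_⟩)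
  · filter_upwards [hLS, heL] with w hw hew hwS using hw.1 (hew.symm ▸ hwS)
  · rw [← hw y hy, hy]
  · exact inCoord_apply h.isOpenEmbedding.injective u y

theorem exists_extendsOn_iff (h : IsAnalyticCurve t ι e) (hS : IsSideInChart t e S O) :
    (∃ x, ∃ r > 0, ExtendsOn ι S u (ι x) r) ↔
      inCoord t u ∉ nowhereExtendable (range t) {O} := by
  simp only [nowhereExtendable, mem_ofPred_eq, mem_singleton_iff, forall_eq, forall_mem_range]
  push Not
  exact exists_congr fun x => ⟨fun ⟨_, hr, hu⟩ => h.exists_extendsOn_inCoord hS hr hu,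
    fun ⟨_, hr, hu⟩ => h.exists_extendsOn_of_inCoord hS hr hu⟩

theorem continuous_toFun (h : IsAnalyticCurve t ι e) (u : Ck t k) : Continuous u.toFun := by
  have hu : inCoord t u.toFun ∘ t = u.toFun :=
    Function.extend_comp h.isOpenEmbedding.injective u.toFun 0
  rw [← hu]
  exact u.contDiff.continuousOn.comp_continuous h.isOpenEmbedding.continuous mem_range_self

theorem mem_nonextSide_iff (h : IsAnalyticCurve t ι e) (hS : IsSideInChart t e S O)
    (u : Ck t k) : u.toFun ∈ NonextSide ι S ↔
      inCoord t u.toFun ∈ nowhereExtendable (range t) {O} := by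
  rw [NonextSide, mem_ofPred_eq, not_iff_comm, ← h.exists_extendsOn_iff hS]
  simp only [extendsFromSideAt_iff h.isEmbedding (h.continuous_toFun u)]

theorem mem_nonextBothSides_iff (h : IsAnalyticCurve t ι e) (hS : IsSideInChart t e S O)
    (hS' : IsSideInChart t e S' O') (u : Ck t k) : u.toFun ∈ NonextBothSides ι S S' ↔
      inCoord t u.toFun ∈ nowhereExtendable (range t) {O, O'} := by
  have hboth : u.toFun ∈ NonextBothSides ι S S' ↔
      u.toFun ∈ NonextSide ι S ∧ u.toFun ∈ NonextSide ι S' := Iff.rfl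
  rw [hboth, h.mem_nonextSide_iff hS, h.mem_nonextSide_iff hS']
  simp only [nowhereExtendable, mem_ofPred_eq, mem_insert_iff, mem_singleton_iff,
    forall_eq_or_imp, forall_eq]

theorem mem_nonextDisc_iff (h : IsAnalyticCurve t ι e) : u ∈ NonextDisc ι ↔
    inCoord t u ∈ nowhereExtendable (range t) {univ} := by
  have huniv : IsSideInChart t e univ univ := fun _ => .of_forall fun _ => Iff.rfl
  rw [NonextDisc, mem_ofPred_eq, not_iff_comm, ← h.exists_extendsOn_iff huniv]
  simp only [extendsToDiscAt_iff]

end IsAnalyticCurve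

theorem DenseGdeltaInSpaces.congr {U V : Set (X → ℂ)} (hU : DenseGdeltaInSpaces t k U)
    (h : ∀ u : Ck t k, u.toFun ∈ V ↔ u.toFun ∈ U) : DenseGdeltaInSpaces t k V := by
  have hb (u : Ckb t k) : u.toFun ∈ V ↔ u.toFun ∈ U := h u.toCk
  have h₀ (u : Ck0 t k) : u.toFun ∈ V ↔ u.toFun ∈ U := h u.toCk
  simpa only [DenseGdeltaInSpaces, h, hb, h₀] using hU

end AnalyticCurves

section Examples

theorem isAnalyticCurve_lineIncl_comp {X : Type} [TopologicalSpace X] {t : X → ℝ}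
    (ht : IsOpenEmbedding t) : IsAnalyticCurve t (lineIncl ∘ t) id where
  isOpenEmbedding := ht
  isEmbedding := Complex.isometry_ofReal.isEmbedding.comp ht.isEmbedding
  incl_eq _ := rfl
  analyticAt _ := analyticAt_id
  deriv_ne_zero _ := by simp only [deriv_id, ne_eq, one_ne_zero, not_false_eq_true]

theorem isSideInChart_id {X : Type} (t : X → ℝ) (O : Set ℂ) : IsSideInChart t id O O :=
  fun _ => .of_forall fun _ => Iff.rfl

/-- The chart `z ↦ e^{iz}` of the unit circle. -/
noncomputable def circleChart (z : ℂ) : ℂ := Complex.exp (z * Complex.I)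

theorem hasDerivAt_circleChart (z : ℂ) :
    HasDerivAt circleChart (circleChart z * Complex.I) z := by
  have h := ((hasDerivAt_id z).mul_const Complex.I).cexp
  rwa [one_mul] at h

theorem norm_circleChart (z : ℂ) : ‖circleChart z‖ = Real.exp (-z.im) := by
  rw [circleChart, Complex.norm_exp, Complex.mul_I_re]

theorem isSideInChart_outerSide {X : Type} (t : X → ℝ) :
    IsSideInChart t circleChart outerSide lowerSide :=
  fun _ => .of_forall fun z => by
    rw [outerSide, mem_ofPred_eq, norm_circleChart, Real.one_lt_exp_iff, neg_pos]
    rfl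

theorem isSideInChart_innerSide {X : Type} (t : X → ℝ) :
    IsSideInChart t circleChart innerSide upperSide :=
  fun _ => .of_forall fun z => by
    rw [innerSide, mem_ofPred_eq, norm_circleChart, Real.exp_lt_one_iff, neg_lt_zero]
    rfl

variable {a b θ : ℝ}

theorem continuous_circlePoint : Continuous circlePoint :=
  (continuous_iff_continuousAt.2 fun z => (hasDerivAt_circleChart z).continuousAt).comp
    Complex.continuous_ofReal

theorem arg_circlePoint_div (hab : b ≤ a + 2 * Real.pi) (hθ : θ ∈ Ioo a b) :
    (circlePoint θ / circlePoint ((a + b) / 2)).arg = θ - (a + b) / 2 := by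
  have hdiv : circlePoint θ / circlePoint ((a + b) / 2) =
      Complex.exp ((θ - (a + b) / 2 : ℝ) * Complex.I) := by
    rw [circlePoint, circlePoint, ← Complex.exp_sub, Complex.ofReal_sub, sub_mul]
  rw [hdiv, Complex.arg_exp_mul_I, toIocMod_eq_self]
  constructor <;> linarith [hθ.1, hθ.2]

theorem injOn_circlePoint (hab : b ≤ a + 2 * Real.pi) : InjOn circlePoint (Ioo a b) :=
  fun θ hθ η hη h => by
    have harg := arg_circlePoint_div hab hθ
    rw [h, arg_circlePoint_div hab hη] at harg
    exact (sub_left_injective harg).symm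

theorem arg_div_circlePoint_midpoint (hab : b ≤ a + 2 * Real.pi) (z : openArc a b) :
    ((z : ℂ) / circlePoint ((a + b) / 2)).arg = arcAngle a b z - (a + b) / 2 := by
  rw [← arg_circlePoint_div hab (arcAngle_mem a b z), circlePoint_arcAngle]

theorem continuous_arcAngle (hab : b ≤ a + 2 * Real.pi) : Continuous (arcAngle a b) := by
  have harg : arcAngle a b =
      fun z : openArc a b => ((z : ℂ) / circlePoint ((a + b) / 2)).arg + (a + b) / 2 := by
    funext z
    rw [arg_div_circlePoint_midpoint hab, sub_add_cancel]
  rw [harg]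
  refine .add (Complex.continuousOn_arg.comp_continuous (by fun_prop) fun z => ?_)
    continuous_const
  refine Complex.mem_slitPlane_iff_arg.2 ⟨?_, div_ne_zero ?_ (Complex.exp_ne_zero _)⟩
  · rw [arg_div_circlePoint_midpoint hab]
    linarith [(arcAngle_mem a b z).1, (arcAngle_mem a b z).2]
  · rw [← circlePoint_arcAngle a b z]
    exact Complex.exp_ne_zero _

theorem range_arcAngle (hab : b ≤ a + 2 * Real.pi) : range (arcAngle a b) = Ioo a b := by
  refine (range_subset_iff.2 (arcAngle_mem a b)).antisymm fun θ hθ => ?_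
  exact ⟨⟨circlePoint θ, mem_image_of_mem _ hθ⟩,
    injOn_circlePoint hab (arcAngle_mem a b _) hθ (circlePoint_arcAngle a b _)⟩

theorem isOpenEmbedding_arcAngle (hab : b ≤ a + 2 * Real.pi) :
    IsOpenEmbedding (arcAngle a b) := by
  have hval : circlePoint ∘ arcAngle a b = Subtype.val := funext (circlePoint_arcAngle a b)
  refine ⟨.of_comp (continuous_arcAngle hab) continuous_circlePoint ?_, ?_⟩
  · rw [hval]
    exact .subtypeVal
  · rw [range_arcAngle hab]
    exact isOpen_Ioo

theorem isAnalyticCurve_arcIncl (hab : b ≤ a + 2 * Real.pi) :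
    IsAnalyticCurve (arcAngle a b) (arcIncl a b) circleChart where
  isOpenEmbedding := isOpenEmbedding_arcAngle hab
  isEmbedding := .subtypeVal
  incl_eq z := (circlePoint_arcAngle a b z).symm
  analyticAt _ := Differentiable.analyticAt (fun z => (hasDerivAt_circleChart z).differentiableAt) _
  deriv_ne_zero _ := by
    rw [(hasDerivAt_circleChart _).deriv]
    exact mul_ne_zero (Complex.exp_ne_zero _) Complex.I_ne_zero

end Examples

end OneSidedExtension

theorem theorem4p20_general {X : Type} [TopologicalSpace X] {t : X → ℝ} {ι : X → ℂ} {e : ℂ → ℂ}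
    {S S' O O' : Set ℂ} (h : IsAnalyticCurve t ι e) (hS : IsSideInChart t e S O)
    (hS' : IsSideInChart t e S' O') (hO : O ∈ modelRegions) (hO' : O' ∈ modelRegions) (k : ℕ∞) :
    DenseGdeltaInSpaces t k (NonextSide ι S) ∧ DenseGdeltaInSpaces t k (NonextSide ι S') ∧
      DenseGdeltaInSpaces t k (NonextBothSides ι S S') ∧
      DenseGdeltaInSpaces t k (NonextDisc ι) := by
  have hdense {𝒪 : Set (Set ℂ)} (h𝒪 : 𝒪 ⊆ modelRegions) :=
    denseGdeltaInSpaces_nowhereExtendable h.isOpenEmbedding k h𝒪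
  refine ⟨?_, ?_, ?_, ?_⟩
  · exact (hdense (singleton_subset_iff.2 hO)).congr (h.mem_nonextSide_iff hS)
  · exact (hdense (singleton_subset_iff.2 hO')).congr (h.mem_nonextSide_iff hS')
  · exact (hdense (pair_subset hO hO')).congr (h.mem_nonextBothSides_iff hS hS')
  · exact (hdense (singleton_subset_iff.2 univ_mem_modelRegions)).congr
      fun _ => h.mem_nonextDisc_iff

theorem theorem4p20 (k : ℕ∞) :
    -- the real line
    (DenseGdeltaInSpaces (id : ℝ → ℝ) k (NonextSide lineIncl upperSide) ∧
     DenseGdeltaInSpaces (id : ℝ → ℝ) k (NonextSide lineIncl lowerSide) ∧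
     DenseGdeltaInSpaces (id : ℝ → ℝ) k (NonextBothSides lineIncl upperSide lowerSide) ∧
     DenseGdeltaInSpaces (id : ℝ → ℝ) k (NonextDisc lineIncl)) ∧
    -- bounded open intervals
    (∀ γ δ : ℝ, γ < δ →
      DenseGdeltaInSpaces (Subtype.val : Set.Ioo γ δ → ℝ) k
        (NonextSide (intervalIncl γ δ) upperSide) ∧
      DenseGdeltaInSpaces (Subtype.val : Set.Ioo γ δ → ℝ) k
        (NonextSide (intervalIncl γ δ) lowerSide) ∧
      DenseGdeltaInSpaces (Subtype.val : Set.Ioo γ δ → ℝ) k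
        (NonextBothSides (intervalIncl γ δ) upperSide lowerSide) ∧
      DenseGdeltaInSpaces (Subtype.val : Set.Ioo γ δ → ℝ) k
        (NonextDisc (intervalIncl γ δ))) ∧
    -- open arcs of the unit circle
    (∀ a b : ℝ, a < b → b ≤ a + 2 * Real.pi →
      DenseGdeltaInSpaces (arcAngle a b) k (NonextSide (arcIncl a b) outerSide) ∧
      DenseGdeltaInSpaces (arcAngle a b) k (NonextSide (arcIncl a b) innerSide) ∧
      DenseGdeltaInSpaces (arcAngle a b) k
        (NonextBothSides (arcIncl a b) outerSide innerSide) ∧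
      DenseGdeltaInSpaces (arcAngle a b) k (NonextDisc (arcIncl a b))) := by
  have up := upperSide_mem_modelRegions
  have low := lowerSide_mem_modelRegions
  refine ⟨?_, fun γ δ _ => ?_, fun a b _ hab => ?_⟩
  · exact theorem4p20_general (isAnalyticCurve_lineIncl_comp .id)
      (isSideInChart_id _ _) (isSideInChart_id _ _) up low k
  · exact theorem4p20_general (isAnalyticCurve_lineIncl_comp isOpen_Ioo.isOpenEmbedding_subtypeVal)
      (isSideInChart_id _ _) (isSideInChart_id _ _) up low k
  · exact theorem4p20_general (isAnalyticCurve_arcIncl hab)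
      (isSideInChart_outerSide _) (isSideInChart_innerSide _) low up k
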